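/- All graphs are simple. A finite graph is 2-connected if it has at least three vertices, is connected, and remains connected after the deletion of any one vertex. For an integer $n>2$, let $\Theta_n$ be the family of graphs that consist of (that is, are the union of) $n$ distinct paths between two distinct vertices $a$ and $b$, any two of which have only $a$ and $b$ in common. Let $\Lambda_n$ be the family of graphs $G$ obtained as follows: for some $m\ge n$, take disjoint graphs $G_1,\dots,G_m$, each isomorphic to $K_3$ or $K_4$; for each $i$ let $e^i$ and $f^i$ be distinct edges of $G_i$, with no common end if $G_i\cong K_4$; identify $f^i$ with $e^{i+1}$ for all $i=1,\dots,m-1$; and then delete some (possibly all or none) of the $m-1$ identified edges. **Theorem.** For every integer $r>2$ there is an integer $f(r)$ such that every finite 2-connected graph with at least $f(r)$ vertices contains, as an induced subgraph, $K_r$, or a member of $\Theta_r$, or a member of $\Lambda_r$. -/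

import Mathlib

universe u

/-- A graph is 2-connected if it has more than two vertices, is connected, and remains connected
after the deletion of any one vertex. -/
def IsTwoConnected {V : Type u} (G : SimpleGraph V) : Prop :=
  2 < ENat.card V ∧ G.Connected ∧ ∀ v : V, (G.induce ({v}ᶜ : Set V)).Connected

/-- `G` is a member of the family `Θ_n`: it consists of two distinct vertices `a`, `b` and
`n` distinct paths between them, any two of which share only `a` and `b`. -/
def IsTheta {V : Type u} (n : ℕ) (G : SimpleGraph V) : Prop :=
  ∃ (a b : V) (P : Fin n → G.Path a b),
    a ≠ b ∧
    Function.Injective P ∧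
    (∀ i j : Fin n, i ≠ j → ∀ x : V,
      x ∈ (P i : G.Walk a b).support → x ∈ (P j : G.Walk a b).support → x = a ∨ x = b) ∧
    (∀ x : V, ∃ i : Fin n, x ∈ (P i : G.Walk a b).support) ∧
    (∀ d ∈ G.edgeSet, ∃ i : Fin n, d ∈ (P i : G.Walk a b).edges)

/-- `G` is obtained from disjoint complete graphs `G_0, …, G_{m-1}`, each with three or four
vertices, and edges `e i`, `f i` of `G_i`, by identifying `f i` with `e (i+1)` for all `i + 1 < m`
and then deleting the identified edges `f i` with `i ∈ D`.

After the identification, `Q i` is the vertex set of (the image of) `G_i`; that nothing except the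
prescribed edge is identified is expressed by `inter`: the only vertices that `G_{i+1}` shares with
the union of its predecessors are the two ends of `f i = e (i+1)`. Only the values of `Q`, `e`, `f`
at indices below `m` matter. -/
structure IsLadder {V : Type u} (G : SimpleGraph V) (m : ℕ)
    (Q : ℕ → Finset V) (e f : ℕ → Sym2 V) (D : Set ℕ) : Prop where
  /-- each `G_i` is a `K_3` or a `K_4` -/
  card : ∀ i < m, (Q i).card = 3 ∨ (Q i).card = 4
  /-- `e i` is an edge of `G_i` -/
  left : ∀ i < m, ¬ (e i).IsDiag ∧ ∀ x ∈ e i, x ∈ Q i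
  /-- `f i` is an edge of `G_i` -/
  right : ∀ i < m, ¬ (f i).IsDiag ∧ ∀ x ∈ f i, x ∈ Q i
  /-- `e i` and `f i` are distinct -/
  ne : ∀ i < m, e i ≠ f i
  /-- in a `K_4`, the edges `e i` and `f i` have no common end -/
  opposite : ∀ i < m, (Q i).card = 4 → ∀ x ∈ e i, x ∉ f i
  /-- `f i` is identified with `e (i+1)` -/
  glue : ∀ i, i + 1 < m → f i = e (i + 1)
  /-- no other identifications take place -/
  inter : ∀ i, i + 1 < m → ∀ x ∈ Q (i + 1), (∃ j ≤ i, x ∈ Q j) → x ∈ f i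
  /-- every vertex comes from some `G_i` -/
  cover : ∀ x : V, ∃ i < m, x ∈ Q i
  /-- only identified edges are deleted -/
  deleted : ∀ i ∈ D, i + 1 < m
  /-- the edges of `G` are the edges of all `G_i` except the deleted ones -/
  adj : ∀ x y : V, G.Adj x y ↔
    x ≠ y ∧ (∃ i < m, x ∈ Q i ∧ y ∈ Q i) ∧ ¬ ∃ i ∈ D, s(x, y) = f i

/-- `G` is a member of the family `Λ_n`: a ladder-like graph, as above, glued together from at
least `n` copies of `K_3` and `K_4`. -/
def IsLambda {V : Type u} (n : ℕ) (G : SimpleGraph V) : Prop :=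
  ∃ m : ℕ, n ≤ m ∧ ∃ (Q : ℕ → Finset V) (e f : ℕ → Sym2 V) (D : Set ℕ), IsLadder G m Q e f D

/-! Let `G` be 2-connected without `K_r`. Suppose first that two vertices `a`, `b` have distance at
least `r`. Choose two internally disjoint `a`–`b` paths of least total length. Shortcutting shows
that both are induced, and exchanging tails shows that two edges between them can cross only if
their ends are consecutive on both paths (`IsDisjointPair.cross`). A lattice path sweeping along
both paths at once then exhibits their union as a ladder: a step on one path gives a triangle, a
crossing gives a `K_4`, and rungs absent from `G` are the deleted edges (`isLambda_of_two_paths`).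

Otherwise all distances are below `r`, so a large `G` has a vertex `v` of large degree, and `G - v`
is connected. If two neighbours of `v` are far apart in `G - v`, a shortest path between them
together with `v` is a ladder of triangles. If not, many neighbours of `v` lie at one common
distance from a fixed neighbour in `G - v`. By Ramsey's theorem and induction on that distance, some
of them are the ends of an induced spider with `r` legs (`exists_spider`), and `v` closes the spider
to a theta graph (`exists_isTheta_of_spider`). -/

/-! ### Ladders from two induced paths -/

/-- A monotone lattice path from `(i, j)` to `(s, t)` that covers all pairs related by `E`, provided
that any two crossing pairs are consecutive in both coordinates. -/
theorem exists_lattice_path (E : ℕ → ℕ → Prop) (s t : ℕ) (last : E s t)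
    (cross : ∀ i i' j j', i < i' → i' ≤ s → j' < j → j ≤ t → E i j → E i' j' →
      i' = i + 1 ∧ j = j' + 1) (d : ℕ) :
    ∀ i j, i ≤ s → j ≤ t → (s - i) + (t - j) = d →
      ∃ (m : ℕ) (I J : ℕ → ℕ), I 0 = i ∧ J 0 = j ∧ I m = s ∧ J m = t ∧
        (∀ k < m, (I (k + 1) = I k + 1 ∧ J (k + 1) = J k) ∨
          (I (k + 1) = I k ∧ J (k + 1) = J k + 1) ∨
          (I (k + 1) = I k + 1 ∧ J (k + 1) = J k + 1 ∧ E (I k) (J k + 1) ∧ E (I k + 1) (J k))) ∧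
        (∀ a b, i ≤ a → a ≤ s → j ≤ b → b ≤ t → E a b → (a = s ∧ b = t) ∨
          ∃ k < m, (a = I k ∨ a = I (k + 1)) ∧ (b = J k ∨ b = J (k + 1))) := by
  induction d using Nat.strong_induction_on with
  | _ d ih =>
  intro i j hi hj hd
  -- One step to `(i', j')` followed by the path from the induction hypothesis. Each pair must be
  -- covered by this step or lie in the rectangle that remains.
  have extend : ∀ i' j', i' ≤ s → j' ≤ t → i + j < i' + j' → i ≤ i' → j ≤ j' →
      ((i' = i + 1 ∧ j' = j) ∨ (i' = i ∧ j' = j + 1) ∨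
        (i' = i + 1 ∧ j' = j + 1 ∧ E i (j + 1) ∧ E (i + 1) j)) →
      (∀ a b, i ≤ a → a ≤ s → j ≤ b → b ≤ t → E a b →
        (i' ≤ a ∧ j' ≤ b) ∨ ((a = i ∨ a = i') ∧ (b = j ∨ b = j'))) →
      ∃ (m : ℕ) (I J : ℕ → ℕ), I 0 = i ∧ J 0 = j ∧ I m = s ∧ J m = t ∧
        (∀ k < m, (I (k + 1) = I k + 1 ∧ J (k + 1) = J k) ∨
          (I (k + 1) = I k ∧ J (k + 1) = J k + 1) ∨
          (I (k + 1) = I k + 1 ∧ J (k + 1) = J k + 1 ∧ E (I k) (J k + 1) ∧ E (I k + 1) (J k))) ∧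
        (∀ a b, i ≤ a → a ≤ s → j ≤ b → b ≤ t → E a b → (a = s ∧ b = t) ∨
          ∃ k < m, (a = I k ∨ a = I (k + 1)) ∧ (b = J k ∨ b = J (k + 1))) := by
    intro i' j' hi' hj' hlt hii hjj hstep hcov
    obtain ⟨m, I, J, hI0, hJ0, hIm, hJm, hs, hc⟩ :=
      ih ((s - i') + (t - j')) (by omega) i' j' hi' hj' rfl
    refine ⟨m + 1, fun k => Nat.casesOn k i I, fun k => Nat.casesOn k j J, rfl, rfl, hIm, hJm,
      ?_, ?_⟩
    · rintro (_ | k) hk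
      · simpa [hI0, hJ0] using hstep
      · exact hs k (by omega)
    · intro a b ha ha' hb hb' hE
      rcases hcov a b ha ha' hb hb' hE with h | h
      · rcases hc a b h.1 ha' h.2 hb' hE with h | ⟨k, hk, h⟩
        · exact Or.inl h
        · exact Or.inr ⟨k + 1, by omega, h⟩
      · refine Or.inr ⟨0, by omega, ?_⟩
        simpa [hI0, hJ0] using h
  by_cases hend : i = s ∧ j = t
  · obtain ⟨rfl, rfl⟩ := hend
    -- A path without steps covers nothing, which is why the corner `(s, t)` is a separate
    -- alternative in the conclusion.
    refine ⟨0, fun _ => i, fun _ => j, rfl, rfl, rfl, rfl, by simp, ?_⟩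
    intro a b h1 h2 h3 h4 _
    exact Or.inl ⟨by omega, by omega⟩
  -- The index `i` can be left behind as soon as it has no partner beyond `j`; below, the same with
  -- the roles exchanged.
  by_cases hA : ∀ b, j < b → b ≤ t → ¬ E i b
  · have his : i < s := by
      by_contra h
      have : i = s := by omega
      subst this
      exact hA t (by omega) le_rfl last
    refine extend (i + 1) j his hj (by omega) (by omega) le_rfl (Or.inl ⟨rfl, rfl⟩) ?_
    intro a b h1 h2 h3 h4 hE
    by_cases ha : a = i
    · subst ha
      have : b = j := by
        by_contra hb
        exact hA b (by omega) h4 hE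
      exact Or.inr ⟨Or.inl rfl, Or.inl this⟩
    · exact Or.inl ⟨by omega, h3⟩
  by_cases hB : ∀ a, i < a → a ≤ s → ¬ E a j
  · have hjt : j < t := by
      by_contra h
      have : j = t := by omega
      subst this
      exact hB s (by omega) le_rfl last
    refine extend i (j + 1) hi hjt (by omega) le_rfl (by omega) (Or.inr (Or.inl ⟨rfl, rfl⟩)) ?_
    intro a b h1 h2 h3 h4 hE
    by_cases hb : b = j
    · subst hb
      have : a = i := by
        by_contra ha
        exact hB a (by omega) h2 hE
      exact Or.inr ⟨Or.inl this, Or.inl rfl⟩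
    · exact Or.inl ⟨h1, by omega⟩
  -- Both `i` and `j` still have later partners. These two pairs cross, hence are consecutive, and
  -- the step is diagonal.
  push Not at hA hB
  obtain ⟨b, hb1, hb2, hEb⟩ := hA
  obtain ⟨a, ha1, ha2, hEa⟩ := hB
  obtain ⟨rfl, rfl⟩ := cross i a b j ha1 ha2 hb1 hb2 hEb hEa
  refine extend (i + 1) (j + 1) ha2 hb2 (by omega) (by omega) (by omega)
    (Or.inr (Or.inr ⟨rfl, rfl, hEb, hEa⟩)) ?_
  intro a b h1 h2 h3 h4 hE
  by_cases ha : a = i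
  · subst ha
    by_cases hb : b = j
    · exact Or.inr ⟨Or.inl rfl, Or.inl hb⟩
    · have := cross a (a + 1) b j (by omega) ha2 (by omega) h4 hE hEa
      exact Or.inr ⟨Or.inl rfl, Or.inr this.2⟩
  · by_cases hb : b = j
    · subst hb
      have := cross i a (b + 1) b (by omega) h2 (by omega) hb2 hEb hE
      exact Or.inr ⟨Or.inr this.1, Or.inl rfl⟩
    · exact Or.inl ⟨by omega, by omega⟩

theorem monotone_until_of_step {I : ℕ → ℕ} {m : ℕ} (h : ∀ k < m, I k ≤ I (k + 1)) {k l : ℕ}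
    (hkl : k ≤ l) (hl : l ≤ m) : I k ≤ I l := by
  induction l, hkl using Nat.le_induction with
  | base => exact le_rfl
  | succ n hn ih => exact (ih (by omega)).trans (h n (by omega))

theorem exists_unit_step {I : ℕ → ℕ} {m : ℕ} (h0 : I 0 = 0)
    (h : ∀ k < m, I (k + 1) = I k ∨ I (k + 1) = I k + 1) (k : ℕ) (hk : k ≤ m) (a : ℕ)
    (ha : a < I k) : ∃ l < k, I l = a ∧ I (l + 1) = a + 1 := by
  induction k with
  | zero => omega
  | succ k ih =>
    by_cases hak : a < I k
    · obtain ⟨l, hl, h'⟩ := ih (by omega) hak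
      exact ⟨l, by omega, h'⟩
    · refine ⟨k, by omega, ?_⟩
      rcases h k (by omega) with h' | h' <;> omega

/-- Two disjoint induced paths with adjacent first ends and adjacent last ends, all of whose crossing
edges are consecutive, span a ladder. -/
theorem isLambda_of_two_paths {W : Type u} (H : SimpleGraph W) (p q : ℕ → W) (s t : ℕ)
    (hp : ∀ i j, i ≤ s → j ≤ s → p i = p j → i = j)
    (hq : ∀ i j, i ≤ t → j ≤ t → q i = q j → i = j)
    (hpq : ∀ i j, i ≤ s → j ≤ t → p i ≠ q j)
    (cover : ∀ x, (∃ i ≤ s, p i = x) ∨ ∃ j ≤ t, q j = x)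
    (adjp : ∀ i j, i ≤ s → j ≤ s → (H.Adj (p i) (p j) ↔ i + 1 = j ∨ j + 1 = i))
    (adjq : ∀ i j, i ≤ t → j ≤ t → (H.Adj (q i) (q j) ↔ i + 1 = j ∨ j + 1 = i))
    (first : H.Adj (p 0) (q 0)) (last : H.Adj (p s) (q t))
    (cross : ∀ i i' j j', i < i' → i' ≤ s → j' < j → j ≤ t → H.Adj (p i) (q j) →
      H.Adj (p i') (q j') → i' = i + 1 ∧ j = j' + 1)
    (n : ℕ) (hn : n ≤ s) (hs : 0 < s) : IsLambda n H := by
  classical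
  obtain ⟨m, I, J, hI0, hJ0, hIm, hJm, hst, hcov⟩ := exists_lattice_path
    (fun i j => H.Adj (p i) (q j)) s t last cross _ 0 0 (Nat.zero_le _) (Nat.zero_le _) rfl
  have hIst : ∀ k < m, I (k + 1) = I k ∨ I (k + 1) = I k + 1 := by
    intro k hk; rcases hst k hk with h | h | h <;> omega
  have hJst : ∀ k < m, J (k + 1) = J k ∨ J (k + 1) = J k + 1 := by
    intro k hk; rcases hst k hk with h | h | h <;> omega
  have monI : ∀ {k l}, k ≤ l → l ≤ m → I k ≤ I l := fun h h' =>
    monotone_until_of_step (fun k hk => by rcases hIst k hk with h | h <;> omega) h h'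
  have monJ : ∀ {k l}, k ≤ l → l ≤ m → J k ≤ J l := fun h h' =>
    monotone_until_of_step (fun k hk => by rcases hJst k hk with h | h <;> omega) h h'
  have Is : ∀ {k}, k ≤ m → I k ≤ s := fun h => hIm ▸ monI h le_rfl
  have Jt : ∀ {k}, k ≤ m → J k ≤ t := fun h => hJm ▸ monJ h le_rfl
  have hsm : s ≤ m := by
    have : ∀ k ≤ m, I k ≤ k := by
      intro k
      induction k with
      | zero => intro _; omega
      | succ k ih => intro hk; have := ih (by omega); rcases hIst k (by omega) with h | h <;> omega
    have := this m le_rfl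
    omega
  have hm : 0 < m := by omega
  -- The piece between rungs `k` and `k + 1`: the four names denote three vertices at a step on one
  -- path and four at a diagonal step.
  set Q : ℕ → Finset W := fun k => {p (I k), q (J k), p (I (k + 1)), q (J (k + 1))} with hQ
  have memQ : ∀ k x, x ∈ Q k ↔
      x = p (I k) ∨ x = q (J k) ∨ x = p (I (k + 1)) ∨ x = q (J (k + 1)) := by
    intro k x; simp [hQ]
  have pp : ∀ {i j}, i ≤ s → j ≤ s → (p i = p j ↔ i = j) := fun hi hj =>
    ⟨hp _ _ hi hj, fun h => h ▸ rfl⟩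
  have qq : ∀ {i j}, i ≤ t → j ≤ t → (q i = q j ↔ i = j) := fun hi hj =>
    ⟨hq _ _ hi hj, fun h => h ▸ rfl⟩
  have step_card : ∀ k < m, (Q k).card = 3 ∨
      ((Q k).card = 4 ∧ I (k + 1) = I k + 1 ∧ J (k + 1) = J k + 1) := by
    intro k hk
    have a1 := Is (k := k) (by omega)
    have a2 := Is (k := k + 1) (by omega)
    have b1 := Jt (k := k) (by omega)
    have b2 := Jt (k := k + 1) (by omega)
    rcases hst k hk with ⟨h1, h2⟩ | ⟨h1, h2⟩ | ⟨h1, h2, _⟩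
    · left
      rw [Finset.card_eq_three]
      refine ⟨p (I k), p (I k + 1), q (J k), ?_, hpq _ _ a1 b1, hpq _ _ (h1 ▸ a2) b1, ?_⟩
      · rw [Ne, pp a1 (h1 ▸ a2)]; omega
      · ext x; rw [memQ, h1, h2]; simp only [Finset.mem_insert, Finset.mem_singleton]; tauto
    · left
      rw [Finset.card_eq_three]
      refine ⟨p (I k), q (J k), q (J k + 1), hpq _ _ a1 b1, hpq _ _ a1 (h2 ▸ b2), ?_, ?_⟩
      · rw [Ne, qq b1 (h2 ▸ b2)]; omega
      · ext x; rw [memQ, h1, h2]; simp only [Finset.mem_insert, Finset.mem_singleton]; tauto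
    · right
      refine ⟨?_, h1, h2⟩
      have e1 : p (I k) ≠ p (I (k + 1)) := by rw [Ne, pp a1 a2]; omega
      have e2 : q (J k) ≠ q (J (k + 1)) := by rw [Ne, qq b1 b2]; omega
      have e3 := hpq _ _ a1 b1
      have e4 := hpq _ _ a1 b2
      have e5 := hpq _ _ a2 b1
      have e6 := hpq _ _ a2 b2
      simp only [hQ]
      rw [Finset.card_insert_of_notMem, Finset.card_insert_of_notMem, Finset.card_pair e6]
      · simp [e5.symm, e2]
      · simp [e1, e3, e4]
  have inQp : ∀ a ≤ s, ∃ k < m, a = I k ∨ a = I (k + 1) := by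
    intro a ha
    rcases Nat.lt_or_ge a s with h | h
    · obtain ⟨l, hl, h1, h2⟩ := exists_unit_step hI0 hIst m le_rfl a (by omega)
      exact ⟨l, hl, Or.inl h1.symm⟩
    · refine ⟨m - 1, by omega, Or.inr ?_⟩
      rw [Nat.sub_add_cancel hm]; omega
  have inQq : ∀ a ≤ t, ∃ k < m, a = J k ∨ a = J (k + 1) := by
    intro a ha
    rcases Nat.lt_or_ge a t with h | h
    · obtain ⟨l, hl, h1, h2⟩ := exists_unit_step hJ0 hJst m le_rfl a (by omega)
      exact ⟨l, hl, Or.inl h1.symm⟩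
    · refine ⟨m - 1, by omega, Or.inr ?_⟩
      rw [Nat.sub_add_cancel hm]; omega
  -- The deleted edges are the inner rungs that are not edges of `H`. The two outer rungs are edges
  -- by `first` and `last`.
  set D : Set ℕ := {k | k + 1 < m ∧ ¬ H.Adj (p (I (k + 1))) (q (J (k + 1)))} with hD
  refine ⟨m, hn.trans hsm, Q, fun k => s(p (I k), q (J k)),
    fun k => s(p (I (k + 1)), q (J (k + 1))), D, ?_⟩
  constructor
  · intro i hi
    rcases step_card i hi with h | h
    exacts [Or.inl h, Or.inr h.1]
  · intro i hi
    refine ⟨by simpa using hpq _ _ (Is (by omega)) (Jt (by omega)), ?_⟩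
    intro x hx
    rw [Sym2.mem_iff] at hx
    rw [memQ]; tauto
  · intro i hi
    refine ⟨by simpa using hpq _ _ (Is (by omega)) (Jt (by omega)), ?_⟩
    intro x hx
    rw [Sym2.mem_iff] at hx
    rw [memQ]; tauto
  · intro i hi h
    have a1 := Is (k := i) (by omega)
    have a2 := Is (k := i + 1) (by omega)
    have b1 := Jt (k := i) (by omega)
    have b2 := Jt (k := i + 1) (by omega)
    rw [Sym2.eq_iff] at h
    rcases h with ⟨h1, h2⟩ | ⟨h1, _⟩
    · rw [pp a1 a2] at h1
      rw [qq b1 b2] at h2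
      rcases hst i hi with h | h | h <;> omega
    · exact hpq _ _ a1 b2 h1
  · intro i hi hc x hx hx'
    have a1 := Is (k := i) (by omega)
    have a2 := Is (k := i + 1) (by omega)
    have b1 := Jt (k := i) (by omega)
    have b2 := Jt (k := i + 1) (by omega)
    rcases step_card i hi with h | ⟨_, h1, h2⟩
    · omega
    rw [Sym2.mem_iff] at hx hx'
    rcases hx with rfl | rfl <;> rcases hx' with h | h
    · rw [pp a1 a2] at h; omega
    · exact hpq _ _ a1 b2 h
    · exact hpq _ _ a2 b1 h.symm
    · rw [qq b1 b2] at h; omega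
  · intro i _; rfl
  · rintro i hi x hx ⟨j, hj, hxj⟩
    have a1 := Is (k := i + 1) (by omega)
    have a2 := Is (k := i + 1 + 1) (by omega)
    have b1 := Jt (k := i + 1) (by omega)
    have b2 := Jt (k := i + 1 + 1) (by omega)
    have c1 := Is (k := j) (by omega)
    have c2 := Is (k := j + 1) (by omega)
    have d1 := Jt (k := j) (by omega)
    have d2 := Jt (k := j + 1) (by omega)
    have m1 := monI (k := j) (l := j + 1) (by omega) (by omega)
    have m2 := monI (k := j + 1) (l := i + 1) (by omega) (by omega)
    have m3 := monI (k := i + 1) (l := i + 1 + 1) (by omega) (by omega)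
    have n1 := monJ (k := j) (l := j + 1) (by omega) (by omega)
    have n2 := monJ (k := j + 1) (l := i + 1) (by omega) (by omega)
    have n3 := monJ (k := i + 1) (l := i + 1 + 1) (by omega) (by omega)
    rw [Sym2.mem_iff]
    rw [memQ] at hx hxj
    rcases hx with h | h | h | h
    · exact Or.inl h
    · exact Or.inr h
    · left
      rcases hxj with h' | h' | h' | h'
      · rw [h, pp a2 c1] at h'; rw [h]; congr 1; omega
      · exact absurd (h.symm.trans h') (hpq _ _ a2 d1)
      · rw [h, pp a2 c2] at h'; rw [h]; congr 1; omega
      · exact absurd (h.symm.trans h') (hpq _ _ a2 d2)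
    · right
      rcases hxj with h' | h' | h' | h'
      · exact absurd (h'.symm.trans h) (hpq _ _ c1 b2)
      · rw [h, qq b2 d1] at h'; rw [h]; congr 1; omega
      · exact absurd (h'.symm.trans h) (hpq _ _ c2 b2)
      · rw [h, qq b2 d2] at h'; rw [h]; congr 1; omega
  · intro x
    rcases cover x with ⟨i, hi, rfl⟩ | ⟨i, hi, rfl⟩
    · obtain ⟨k, hk, h⟩ := inQp i hi
      refine ⟨k, hk, ?_⟩
      rw [memQ]
      rcases h with rfl | rfl <;> simp
    · obtain ⟨k, hk, h⟩ := inQq i hi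
      refine ⟨k, hk, ?_⟩
      rw [memQ]
      rcases h with rfl | rfl <;> simp
  · intro i hi; exact hi.1
  · intro x y
    constructor
    · intro hxy
      refine ⟨hxy.ne, ?_, ?_⟩
      · have mixed : ∀ a ≤ s, ∀ b ≤ t, H.Adj (p a) (q b) → ∃ k < m, p a ∈ Q k ∧ q b ∈ Q k := by
          intro a ha b hb hab
          have : ∃ k < m, (a = I k ∨ a = I (k + 1)) ∧ (b = J k ∨ b = J (k + 1)) := by
            rcases hcov a b (Nat.zero_le _) ha (Nat.zero_le _) hb hab with ⟨h1, h2⟩ | h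
            · refine ⟨m - 1, by omega, Or.inr ?_, Or.inr ?_⟩ <;>
                rw [Nat.sub_add_cancel hm] <;> omega
            · exact h
          obtain ⟨k, hk, h1, h2⟩ := this
          refine ⟨k, hk, ?_, ?_⟩ <;> rw [memQ]
          · rcases h1 with rfl | rfl <;> simp
          · rcases h2 with rfl | rfl <;> simp
        have pstep : ∀ a, a + 1 ≤ s → ∃ k < m, p a ∈ Q k ∧ p (a + 1) ∈ Q k := by
          intro a ha
          obtain ⟨l, hl, h1, h2⟩ := exists_unit_step hI0 hIst m le_rfl a (by omega)
          refine ⟨l, hl, ?_, ?_⟩ <;> rw [memQ]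
          · rw [h1]; simp
          · rw [h2]; simp
        have qstep : ∀ a, a + 1 ≤ t → ∃ k < m, q a ∈ Q k ∧ q (a + 1) ∈ Q k := by
          intro a ha
          obtain ⟨l, hl, h1, h2⟩ := exists_unit_step hJ0 hJst m le_rfl a (by omega)
          refine ⟨l, hl, ?_, ?_⟩ <;> rw [memQ]
          · rw [h1]; simp
          · rw [h2]; simp
        rcases cover x with ⟨i, hi, rfl⟩ | ⟨i, hi, rfl⟩ <;>
          rcases cover y with ⟨j, hj, rfl⟩ | ⟨j, hj, rfl⟩
        · rcases (adjp i j hi hj).1 hxy with rfl | rfl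
          · exact pstep i hj
          · obtain ⟨k, hk, h1, h2⟩ := pstep j hi
            exact ⟨k, hk, h2, h1⟩
        · exact mixed i hi j hj hxy
        · obtain ⟨k, hk, h1, h2⟩ := mixed j hj i hi hxy.symm
          exact ⟨k, hk, h2, h1⟩
        · rcases (adjq i j hi hj).1 hxy with rfl | rfl
          · exact qstep i hj
          · obtain ⟨k, hk, h1, h2⟩ := qstep j hi
            exact ⟨k, hk, h2, h1⟩
      · rintro ⟨i, hi, h⟩
        rw [Sym2.eq_iff] at h
        rcases h with ⟨rfl, rfl⟩ | ⟨rfl, rfl⟩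
        · exact hi.2 hxy
        · exact hi.2 hxy.symm
    · rintro ⟨hne, ⟨k, hk, hx, hy⟩, hdel⟩
      have a1 := Is (k := k) (by omega)
      have a2 := Is (k := k + 1) (by omega)
      have b1 := Jt (k := k) (by omega)
      have b2 := Jt (k := k + 1) (by omega)
      have rung : ∀ l ≤ m, s(x, y) = s(p (I l), q (J l)) → H.Adj (p (I l)) (q (J l)) := by
        intro l hl h
        by_contra hna
        rcases Nat.eq_zero_or_pos l with rfl | hl0
        · rw [hI0, hJ0] at hna; exact hna first
        rcases Nat.lt_or_ge l m with hlm | hlm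
        · refine hdel ⟨l - 1, ⟨by omega, ?_⟩, ?_⟩
          · rwa [Nat.sub_add_cancel hl0]
          · rw [h]; simp only [Nat.sub_add_cancel hl0]
        · have : l = m := by omega
          subst this
          rw [hIm, hJm] at hna; exact hna last
      have r1 := rung k (by omega)
      have r2 := rung (k + 1) (by omega)
      have key : ∀ {u v}, s(x, y) = s(u, v) → H.Adj u v → H.Adj x y := by
        intro u v h h'
        rw [← SimpleGraph.mem_edgeSet, h]; exact h'
      have pr : I (k + 1) = I k ∨ H.Adj (p (I k)) (p (I (k + 1))) := by
        rcases hIst k hk with h | h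
        · exact Or.inl h
        · exact Or.inr ((adjp _ _ a1 a2).2 (Or.inl h.symm))
      have qr : J (k + 1) = J k ∨ H.Adj (q (J k)) (q (J (k + 1))) := by
        rcases hJst k hk with h | h
        · exact Or.inl h
        · exact Or.inr ((adjq _ _ b1 b2).2 (Or.inl h.symm))
      -- In a triangle this diagonal coincides with a rung; in a `K_4` it is one of the two crossing
      -- edges recorded by the lattice path.
      have d1 : s(x, y) = s(p (I k), q (J (k + 1))) → H.Adj x y := by
        intro h
        refine key h ?_
        rcases hst k hk with ⟨h1, h2⟩ | ⟨h1, h2⟩ | ⟨h1, h2, h3, h4⟩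
        · rw [h2] at h ⊢; exact r1 h
        · rw [← h1] at h ⊢; exact r2 h
        · rw [h2]; exact h3
      have d2 : s(x, y) = s(p (I (k + 1)), q (J k)) → H.Adj x y := by
        intro h
        refine key h ?_
        rcases hst k hk with ⟨h1, h2⟩ | ⟨h1, h2⟩ | ⟨h1, h2, h3, h4⟩
        · rw [← h2] at h ⊢; exact r2 h
        · rw [h1] at h ⊢; exact r1 h
        · rw [h1]; exact h4
      have r1' : s(x, y) = s(p (I k), q (J k)) → H.Adj x y := fun h => key h (r1 h)
      have r2' : s(x, y) = s(p (I (k + 1)), q (J (k + 1))) → H.Adj x y := fun h => key h (r2 h)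
      have pr' : s(x, y) = s(p (I k), p (I (k + 1))) → H.Adj x y := by
        intro h
        rcases pr with h' | h'
        · rw [h'] at h
          exact absurd (Sym2.mk_isDiag_iff.2 rfl) (h ▸ fun hd => hne (Sym2.mk_isDiag_iff.1 hd))
        · exact key h h'
      have qr' : s(x, y) = s(q (J k), q (J (k + 1))) → H.Adj x y := by
        intro h
        rcases qr with h' | h'
        · rw [h'] at h
          exact absurd (Sym2.mk_isDiag_iff.2 rfl) (h ▸ fun hd => hne (Sym2.mk_isDiag_iff.1 hd))
        · exact key h h'
      rw [memQ] at hx hy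
      clear_value Q D
      rcases hx with rfl | rfl | rfl | rfl <;> rcases hy with rfl | rfl | rfl | rfl <;>
      first
      | exact absurd rfl hne
      | exact r1' rfl
      | exact r2' rfl
      | exact d1 rfl
      | exact d2 rfl
      | exact pr' rfl
      | exact qr' rfl
      | exact r1' Sym2.eq_swap
      | exact r2' Sym2.eq_swap
      | exact d1 Sym2.eq_swap
      | exact d2 Sym2.eq_swap
      | exact pr' Sym2.eq_swap
      | exact qr' Sym2.eq_swap

theorem exists_induce_isLambda_of_two_paths {V : Type u} (G : SimpleGraph V) (p q : ℕ → V)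
    (s t : ℕ)
    (hp : ∀ i j, i ≤ s → j ≤ s → p i = p j → i = j)
    (hq : ∀ i j, i ≤ t → j ≤ t → q i = q j → i = j)
    (hpq : ∀ i j, i ≤ s → j ≤ t → p i ≠ q j)
    (adjp : ∀ i j, i ≤ s → j ≤ s → (G.Adj (p i) (p j) ↔ i + 1 = j ∨ j + 1 = i))
    (adjq : ∀ i j, i ≤ t → j ≤ t → (G.Adj (q i) (q j) ↔ i + 1 = j ∨ j + 1 = i))
    (first : G.Adj (p 0) (q 0)) (last : G.Adj (p s) (q t))
    (cross : ∀ i i' j j', i < i' → i' ≤ s → j' < j → j ≤ t → G.Adj (p i) (q j) →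
      G.Adj (p i') (q j') → i' = i + 1 ∧ j = j' + 1)
    (n : ℕ) (hn : n ≤ s) (hs : 0 < s) : ∃ S : Set V, IsLambda n (G.induce S) := by
  let S : Set V := {x | (∃ i ≤ s, p i = x) ∨ ∃ j ≤ t, q j = x}
  -- Indices are clamped so that every value lies in `S`.
  let p' : ℕ → S := fun k => ⟨p (min k s), Or.inl ⟨_, min_le_right _ _, rfl⟩⟩
  let q' : ℕ → S := fun k => ⟨q (min k t), Or.inr ⟨_, min_le_right _ _, rfl⟩⟩
  have ep : ∀ {i}, i ≤ s → (p' i : V) = p i := fun h => by simp [p', min_eq_left h]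
  have eq : ∀ {i}, i ≤ t → (q' i : V) = q i := fun h => by simp [q', min_eq_left h]
  refine ⟨S, isLambda_of_two_paths (G.induce S) p' q' s t ?_ ?_ ?_ ?_ ?_ ?_ ?_ ?_ ?_ n hn hs⟩
  · intro i j hi hj h
    exact hp i j hi hj (by rw [← ep hi, ← ep hj, h])
  · intro i j hi hj h
    exact hq i j hi hj (by rw [← eq hi, ← eq hj, h])
  · intro i j hi hj h
    exact hpq i j hi hj (by rw [← ep hi, ← eq hj, h])
  · rintro ⟨x, ⟨i, hi, rfl⟩ | ⟨i, hi, rfl⟩⟩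
    · exact Or.inl ⟨i, hi, Subtype.ext (ep hi)⟩
    · exact Or.inr ⟨i, hi, Subtype.ext (eq hi)⟩
  · intro i j hi hj
    rw [SimpleGraph.comap_adj, Function.Embedding.subtype_apply, Function.Embedding.subtype_apply,
      ep hi, ep hj]
    exact adjp i j hi hj
  · intro i j hi hj
    rw [SimpleGraph.comap_adj, Function.Embedding.subtype_apply, Function.Embedding.subtype_apply,
      eq hi, eq hj]
    exact adjq i j hi hj
  · rw [SimpleGraph.comap_adj, Function.Embedding.subtype_apply, Function.Embedding.subtype_apply,
      ep (Nat.zero_le _), eq (Nat.zero_le _)]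
    exact first
  · rw [SimpleGraph.comap_adj, Function.Embedding.subtype_apply, Function.Embedding.subtype_apply,
      ep le_rfl, eq le_rfl]
    exact last
  · intro i i' j j' hi hi' hj hj' h h'
    rw [SimpleGraph.comap_adj, Function.Embedding.subtype_apply, Function.Embedding.subtype_apply,
      ep (by omega), eq (by omega)] at h h'
    exact cross i i' j j' hi hi' hj hj' h h'

/-! ### Two internally disjoint paths -/

/-- `p 0, …, p n` is a walk from `a` to `b` that visits `b` only at its end. -/
structure IsWalkFun {V : Type u} (G : SimpleGraph V) (a b : V) (n : ℕ) (p : ℕ → V) : Prop where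
  zero : p 0 = a
  last : p n = b
  adj : ∀ k < n, G.Adj (p k) (p (k + 1))
  ne_last : ∀ k < n, p k ≠ b

/-- Two walks from `a` to `b` that share only `a` and `b`. -/
structure IsDisjointPair {V : Type u} (G : SimpleGraph V) (a b : V) (s t : ℕ) (p q : ℕ → V) :
    Prop where
  left : IsWalkFun G a b s p
  right : IsWalkFun G a b t q
  disj : ∀ k ≤ s, ∀ l ≤ t, p k = q l → p k = a ∨ p k = b

theorem IsDisjointPair.symm {V : Type u} {G : SimpleGraph V} {a b : V} {s t : ℕ} {p q : ℕ → V}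
    (h : IsDisjointPair G a b s t p q) : IsDisjointPair G a b t s q p :=
  ⟨h.right, h.left, fun k hk l hl e => by rw [e]; exact h.disj l hl k hk e.symm⟩

/-- The sequence `p 0, …, p i, q j, q (j + 1), …`. -/
def splice {V : Type u} (p : ℕ → V) (i : ℕ) (q : ℕ → V) (j : ℕ) : ℕ → V :=
  fun x => if x ≤ i then p x else q (x - (i + 1) + j)

theorem exists_of_splice {V : Type u} (p : ℕ → V) (i : ℕ) (q : ℕ → V) {j t : ℕ} (hj : j ≤ t)
    {x : ℕ} (hx : x ≤ i + 1 + (t - j)) : (x ≤ i ∧ splice p i q j x = p x) ∨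
      ∃ y, j ≤ y ∧ y ≤ t ∧ (x < i + 1 + (t - j) → y < t) ∧ splice p i q j x = q y := by
  unfold splice
  split_ifs with h
  · exact Or.inl ⟨h, rfl⟩
  · exact Or.inr ⟨x - (i + 1) + j, by omega, by omega, by omega, rfl⟩

theorem IsWalkFun.splice {V : Type u} {G : SimpleGraph V} {a b : V} {i j t : ℕ} {p q : ℕ → V}
    (zero : p 0 = a) (adjp : ∀ k < i, G.Adj (p k) (p (k + 1))) (nep : ∀ k ≤ i, p k ≠ b)
    (hj : j ≤ t) (last : q t = b) (adjq : ∀ k < t, j ≤ k → G.Adj (q k) (q (k + 1)))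
    (neq : ∀ k < t, j ≤ k → q k ≠ b) (h : G.Adj (p i) (q j)) :
    IsWalkFun G a b (i + 1 + (t - j)) (splice p i q j) where
  zero := by simp [_root_.splice, zero]
  last := by
    have : ¬ (i + 1 + (t - j) ≤ i) := by omega
    have e : i + 1 + (t - j) - (i + 1) + j = t := by omega
    simp only [_root_.splice, if_neg this, e, last]
  adj := by
    intro k hk
    unfold _root_.splice
    rcases Nat.lt_trichotomy k i with h1 | rfl | h1
    · rw [if_pos (by omega), if_pos (by omega)]
      exact adjp k h1
    · rw [if_pos le_rfl, if_neg (by omega)]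
      simpa using h
    · rw [if_neg (by omega), if_neg (by omega)]
      have e : k + 1 - (i + 1) + j = (k - (i + 1) + j) + 1 := by omega
      rw [e]
      exact adjq _ (by omega) (by omega)
  ne_last := by
    intro k hk
    rcases exists_of_splice p i q hj hk.le with ⟨h1, h2⟩ | ⟨y, h1, h2, h3, h4⟩
    · rw [h2]; exact nep k h1
    · rw [h4]; exact neq y (h3 hk) h1

/-- A shortest path has no chord, as a chord would shorten it. -/
theorem exists_path_fun {V : Type u} {G : SimpleGraph V} {a b : V} (h : G.Reachable a b) :
    ∃ (p : ℕ → V), p 0 = a ∧ p (G.dist a b) = b ∧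
      (∀ k < G.dist a b, G.Adj (p k) (p (k + 1))) ∧
      (∀ i j, i ≤ G.dist a b → j ≤ G.dist a b → p i = p j → i = j) ∧
      (∀ i j, i ≤ G.dist a b → j ≤ G.dist a b → G.Adj (p i) (p j) → i + 1 = j ∨ j + 1 = i) := by
  obtain ⟨w, hw, hl⟩ := h.exists_path_of_dist
  have inj : ∀ i j, i ≤ G.dist a b → j ≤ G.dist a b → w.getVert i = w.getVert j → i = j := by
    intro i j hi hj e
    exact hw.getVert_injOn (by simpa [hl] using hi) (by simpa [hl] using hj) e
  have chord : ∀ i j, i < j → j ≤ G.dist a b → G.Adj (w.getVert i) (w.getVert j) → i + 1 = j := by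
    intro i j hij hj hadj
    have := SimpleGraph.dist_le ((w.take i).append (SimpleGraph.Walk.cons hadj (w.drop j)))
    simp only [SimpleGraph.Walk.length_append, SimpleGraph.Walk.length_cons,
      SimpleGraph.Walk.take_length, SimpleGraph.Walk.drop_length, hl] at this
    omega
  refine ⟨w.getVert, by simp, by rw [← hl]; simp, ?_, inj, ?_⟩
  · intro k hk
    exact w.adj_getVert_succ (by omega)
  · intro i j hi hj hadj
    rcases Nat.lt_trichotomy i j with h | rfl | h
    · exact Or.inl (chord i j h hj hadj)
    · exact absurd hadj (G.loopless.irrefl _)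
    · exact Or.inr (chord j i h hi hadj.symm)

/-- The common inductive step: `q` is prolonged by the edge `uw`, and `p` is replaced by a walk `p'`
that reaches `w` without meeting `q` outside `a`. -/
theorem IsDisjointPair.extend {V : Type u} {G : SimpleGraph V} {a u w : V} {s t : ℕ} {p q : ℕ → V}
    (h : IsDisjointPair G a u s t p q) (huw : G.Adj u w) (hqw : ∀ l ≤ t, q l ≠ w)
    {n : ℕ} {p' : ℕ → V} (hp' : IsWalkFun G a w n p')
    (hd : ∀ k < n, ∀ l ≤ t, p' k = q l → p' k = a) :
    ∃ s t p q, IsDisjointPair G a w s t p q := by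
  have e : IsWalkFun G a w (t + 1 + (0 - 0)) (splice q t (fun _ => w) 0) :=
    IsWalkFun.splice h.right.zero h.right.adj hqw le_rfl rfl (by simp) (by simp)
      (by rw [h.right.last]; exact huw)
  refine ⟨n, _, p', _, hp', e, ?_⟩
  intro k hk l hl hkl
  rcases Nat.lt_or_ge k n with hkn | hkn
  · rcases exists_of_splice q t (fun _ => w) (le_refl 0) hl with ⟨h1, h2⟩ | ⟨y, _, _, _, h2⟩
    · exact Or.inl (hd k hkn l h1 (hkl.trans h2))
    · exact Or.inr (hkl.trans h2)
  · right
    have : k = n := by omega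
    rw [this, hp'.last]

/-- In a 2-connected graph any two vertices are joined by two internally disjoint paths. -/
theorem exists_isDisjointPair {V : Type u} {G : SimpleGraph V} (hG : IsTwoConnected G) (a w : V)
    (hw : w ≠ a) : ∃ s t p q, IsDisjointPair G a w s t p q := by
  -- Induction along a walk from `a`: a pair reaching `u` is turned into a pair reaching the next
  -- vertex `w`.
  have hr : Relation.ReflTransGen G.Adj a w :=
    (SimpleGraph.reachable_iff_reflTransGen a w).1 (hG.2.1.preconnected a w)
  induction hr with
  | refl => exact absurd rfl hw
  | @tail u w _ huw ih =>
  by_cases hua : u = a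
  · subst hua
    -- The edge `uw` taken twice counts as a pair, since the two walks need not be distinct.
    have e : IsWalkFun G u w (0 + 1 + (0 - 0)) (splice (fun _ => u) 0 (fun _ => w) 0) :=
      IsWalkFun.splice rfl (by simp) (fun _ _ => huw.ne) le_rfl rfl (by simp) (by simp) huw
    refine ⟨_, _, _, _, e, e, ?_⟩
    intro k hk l hl _
    rcases exists_of_splice (fun _ => u) 0 (fun _ => w) (le_refl 0) hk with ⟨_, h2⟩ | ⟨_, _, _, _, h2⟩
    · exact Or.inl h2
    · exact Or.inr h2
  obtain ⟨s, t, p, q, h⟩ := ih hua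
  -- `w` lies on one of the two walks
  have onWalk : ∀ {s t : ℕ} {p q : ℕ → V}, IsDisjointPair G a u s t p q → (∃ k ≤ s, p k = w) →
      ∃ s t p q, IsDisjointPair G a w s t p q := by
    intro s t p q h hk
    classical
    -- The walk `p` is cut at its first visit to `w`; the other walk misses `w` and continues
    -- through `u`.
    let k := Nat.find hk
    obtain ⟨hks, hkw⟩ : k ≤ s ∧ p k = w := Nat.find_spec hk
    have hmin : ∀ x < k, p x ≠ w := fun x hx e => Nat.find_min hk hx ⟨by omega, e⟩
    have hks' : k < s := by
      rcases Nat.lt_or_ge k s with h' | h'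
      · exact h'
      · have : k = s := by omega
        rw [this, h.left.last] at hkw
        exact absurd hkw huw.ne
    have hwq : ∀ l ≤ t, q l ≠ w := by
      intro l hl e
      rcases h.disj k hks l hl (by rw [hkw, e]) with h' | h'
      · exact hw (hkw.symm.trans h')
      · exact huw.ne (h'.symm.trans hkw)
    refine h.extend huw hwq (n := k) (p' := p)
      ⟨h.left.zero, hkw, fun x hx => h.left.adj x (by omega), hmin⟩ ?_
    intro x hx l hl e
    rcases h.disj x (by omega) l hl e with h' | h'
    · exact h'
    · exact absurd h' (h.left.ne_last x (by omega))
  by_cases hpw : ∃ k ≤ s, p k = w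
  · exact onWalk h hpw
  by_cases hqw : ∃ k ≤ t, q k = w
  · exact onWalk h.symm hqw
  push Not at hpw hqw
  -- reroute through a path that avoids `u`
  obtain ⟨R, hR0, hRn, hRadj, hRinj, -⟩ := exists_path_fun
    ((hG.2.2 u).preconnected ⟨a, fun e => hua e.symm⟩ ⟨w, huw.ne'⟩)
  generalize (G.induce ({u}ᶜ : Set V)).dist _ _ = n at hRn hRadj hRinj
  have offWalk : ∀ {s t : ℕ} {p q : ℕ → V}, IsDisjointPair G a u s t p q →
      (∀ k ≤ s, p k ≠ w) → (∀ k ≤ t, q k ≠ w) → ∀ m ≤ n, ∀ k ≤ s, p k = (R m : V) →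
      (∀ y ≤ n, m < y → (∀ k ≤ s, p k ≠ (R y : V)) ∧ (∀ k ≤ t, q k ≠ (R y : V))) →
      ∃ s t p q, IsDisjointPair G a w s t p q := by
    intro s t p q h hpw hqw m hm k hk hkm hlast
    have hmn : m < n := by
      rcases Nat.lt_or_ge m n with h' | h'
      · exact h'
      · have : m = n := by omega
        rw [this, hRn] at hkm
        exact absurd hkm (hpw k hk)
    have hks : k < s := by
      rcases Nat.lt_or_ge k s with h' | h'
      · exact h'
      · have : k = s := by omega
        rw [this, h.left.last] at hkm
        exact absurd hkm.symm (R m).2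
    -- Along `p` to its meeting point with `R`, then along `R`, which from there on avoids both
    -- walks.
    have e : IsWalkFun G a w (k + 1 + (n - (m + 1))) (splice p k (fun y => (R y : V)) (m + 1)) := by
      refine IsWalkFun.splice h.left.zero (fun x hx => h.left.adj x (by omega))
        (fun x hx => hpw x (by omega)) hmn (by rw [hRn]) (fun y hy _ => hRadj y hy) ?_ ?_
      · intro y hy _ e
        have := hRinj y n hy.le le_rfl (by rw [hRn]; exact Subtype.ext e)
        omega
      · rw [hkm]; exact hRadj m hmn
    refine h.extend huw hqw e ?_
    intro x hx l hl exl
    rcases exists_of_splice p k (fun y => (R y : V)) hmn hx.le with ⟨h1, h2⟩ | ⟨y, h1, h2, _, h3⟩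
    · rw [h2] at exl ⊢
      rcases h.disj x (by omega) l hl exl with h' | h'
      · exact h'
      · exact absurd h' (h.left.ne_last x (by omega))
    · exact absurd (exl.symm.trans h3) ((hlast y h2 (by omega)).2 l hl)
  classical
  -- The last vertex of `R` on either walk is wanted; there is one because `R` starts at `a`.
  let T : ℕ → Prop := fun m => (∃ k ≤ s, p k = (R m : V)) ∨ (∃ k ≤ t, q k = (R m : V))
  have hT0 : T 0 := Or.inl ⟨0, Nat.zero_le _, by rw [hR0, h.left.zero]⟩
  let m := Nat.findGreatest T n
  have hm : m ≤ n := Nat.findGreatest_le n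
  have hTm : T m := Nat.findGreatest_spec (Nat.zero_le n) hT0
  have hlast : ∀ y ≤ n, m < y → (∀ k ≤ s, p k ≠ (R y : V)) ∧ (∀ k ≤ t, q k ≠ (R y : V)) := by
    intro y hy hmy
    have : ¬ T y := Nat.findGreatest_is_greatest hmy hy
    simp only [T] at this
    push Not at this
    exact this
  rcases hTm with ⟨k, hk, e⟩ | ⟨k, hk, e⟩
  · exact offWalk h hpw hqw m hm k hk e hlast
  · exact offWalk h.symm hqw hpw m hm k hk e fun y hy hmy => (hlast y hy hmy).symm

/-! ### Shortest pairs of paths and long ladders -/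

theorem dist_le_of_steps {V : Type u} {G : SimpleGraph V} (hG : G.Connected) {n : ℕ} {p : ℕ → V}
    (h : ∀ k < n, G.Adj (p k) (p (k + 1))) : ∀ k ≤ n, G.dist (p 0) (p k) ≤ k := by
  intro k
  induction k with
  | zero => intro _; simp
  | succ k ih =>
    intro hk
    have h1 := ih (by omega)
    have h2 := hG.dist_triangle (u := p 0) (v := p k) (w := p (k + 1))
    have h3 := SimpleGraph.dist_eq_one_iff_adj.2 (h k (by omega))
    omega

theorem IsWalkFun.dist_le {V : Type u} {G : SimpleGraph V} (hG : G.Connected) {a b : V} {n : ℕ}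
    {p : ℕ → V} (h : IsWalkFun G a b n p) : G.dist a b ≤ n := by
  have := dist_le_of_steps hG h.adj n le_rfl
  rwa [h.zero, h.last] at this

theorem exists_pred_of_dist {V : Type u} {G : SimpleGraph V} (hG : G.Connected) (a x : V) (n : ℕ)
    (h : G.dist a x = n + 1) : ∃ y, G.Adj y x ∧ G.dist a y = n := by
  obtain ⟨p, h0, hl, hadj, -⟩ := exists_path_fun (hG.preconnected a x)
  rw [h] at hl hadj
  have hx : G.Adj (p n) x := hl ▸ hadj n (by omega)
  have h1 := dist_le_of_steps hG hadj n (by omega)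
  have h2 := hG.dist_triangle (u := a) (v := p n) (w := x)
  rw [SimpleGraph.dist_eq_one_iff_adj.2 hx] at h2
  rw [h0] at h1
  exact ⟨p n, hx, by omega⟩

section Minimal

variable {V : Type u} {G : SimpleGraph V} {a b : V} {s t : ℕ} {p q : ℕ → V}

/-- Shortcutting `p` along a chord keeps the pair disjoint and lowers the total length. -/
theorem IsDisjointPair.chordless (h : IsDisjointPair G a b s t p q)
    (hmin : ∀ s' t' p' q', IsDisjointPair G a b s' t' p' q' → s + t ≤ s' + t')
    {i j : ℕ} (hij : i < j) (hj : j ≤ s) (hadj : G.Adj (p i) (p j)) : j = i + 1 := by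
  have e : IsWalkFun G a b (i + 1 + (s - j)) (splice p i p j) :=
    IsWalkFun.splice h.left.zero (fun k hk => h.left.adj k (by omega))
      (fun k hk => h.left.ne_last k (by omega)) hj h.left.last (fun k hk _ => h.left.adj k hk)
      (fun k hk _ => h.left.ne_last k hk) hadj
  have := hmin _ _ _ _ ⟨e, h.right, fun k hk l hl ekl => by
    rcases exists_of_splice p i p hj hk with ⟨h1, h2⟩ | ⟨y, h1, h2, _, h3⟩
    · rw [h2] at ekl ⊢; exact h.disj k (by omega) l hl ekl
    · rw [h3] at ekl ⊢; exact h.disj y h2 l hl ekl⟩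
  omega

/-- If `p i = p j` with `i < j`, then `p i` is adjacent to `p (j + 1)`, a forbidden chord; `j < s`
because `b` occurs only at the end. -/
theorem IsDisjointPair.injOn (h : IsDisjointPair G a b s t p q)
    (hmin : ∀ s' t' p' q', IsDisjointPair G a b s' t' p' q' → s + t ≤ s' + t')
    (i j : ℕ) (hi : i ≤ s) (hj : j ≤ s) (hij : p i = p j) : i = j := by
  have key : ∀ i j, i < j → j ≤ s → p i ≠ p j := by
    intro i j hij hj e
    have hjs : j < s := by
      rcases Nat.lt_or_ge j s with h' | h'
      · exact h'
      · have : j = s := by omega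
        rw [this, h.left.last] at e
        exact absurd e (h.left.ne_last i (by omega))
    have := h.chordless hmin (i := i) (j := j + 1) (by omega) hjs (e ▸ h.left.adj j hjs)
    omega
  rcases Nat.lt_trichotomy i j with h' | h' | h'
  · exact absurd hij (key i j h' hj)
  · exact h'
  · exact absurd hij.symm (key j i h' hi)

theorem IsDisjointPair.adj_iff (h : IsDisjointPair G a b s t p q)
    (hmin : ∀ s' t' p' q', IsDisjointPair G a b s' t' p' q' → s + t ≤ s' + t')
    (i j : ℕ) (hi : i ≤ s) (hj : j ≤ s) : G.Adj (p i) (p j) ↔ i + 1 = j ∨ j + 1 = i := by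
  constructor
  · intro hadj
    rcases Nat.lt_trichotomy i j with h' | rfl | h'
    · exact Or.inl (h.chordless hmin h' hj hadj).symm
    · exact absurd hadj (G.loopless.irrefl _)
    · exact Or.inr (h.chordless hmin h' hi hadj.symm).symm
  · rintro (rfl | rfl)
    · exact h.left.adj i (by omega)
    · exact (h.left.adj j (by omega)).symm

/-- Exchanging tails along the two crossing edges gives another disjoint pair, of total length `s +
t + 2 - (i' - i) - (j - j')`. Minimality forces both differences to be 1. -/
theorem IsDisjointPair.cross (h : IsDisjointPair G a b s t p q)
    (hmin : ∀ s' t' p' q', IsDisjointPair G a b s' t' p' q' → s + t ≤ s' + t')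
    {i i' j j' : ℕ} (hi : i < i') (hi' : i' ≤ s) (hj : j' < j) (hj' : j ≤ t)
    (h1 : G.Adj (p i) (q j)) (h2 : G.Adj (p i') (q j')) : i' = i + 1 ∧ j = j' + 1 := by
  have injp := h.injOn hmin
  have injq := h.symm.injOn fun s' t' p' q' h' => by
    have := hmin _ _ _ _ h'.symm; omega
  have e1 : IsWalkFun G a b (i + 1 + (t - j)) (splice p i q j) :=
    IsWalkFun.splice h.left.zero (fun k hk => h.left.adj k (by omega))
      (fun k hk => h.left.ne_last k (by omega)) hj' h.right.last (fun k hk _ => h.right.adj k hk)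
      (fun k hk _ => h.right.ne_last k hk) h1
  have e2 : IsWalkFun G a b (j' + 1 + (s - i')) (splice q j' p i') :=
    IsWalkFun.splice h.right.zero (fun k hk => h.right.adj k (by omega))
      (fun k hk => h.right.ne_last k (by omega)) hi' h.left.last (fun k hk _ => h.left.adj k hk)
      (fun k hk _ => h.left.ne_last k hk) h2.symm
  have := hmin _ _ _ _ ⟨e1, e2, fun k hk l hl ekl => by
    rcases exists_of_splice p i q hj' hk with ⟨h1, h2⟩ | ⟨y, h1, h2, _, h3⟩ <;>
      rcases exists_of_splice q j' p hi' hl with ⟨h4, h5⟩ | ⟨z, h4, h5, _, h6⟩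
    · rw [h2, h5] at ekl; rw [h2]; exact h.disj k (by omega) l (by omega) ekl
    · rw [h2, h6] at ekl
      have := injp k z (by omega) h5 ekl
      omega
    · rw [h3, h5] at ekl
      have := injq y l h2 (by omega) ekl
      omega
    · rw [h3, h6] at ekl; rw [h3, ekl]; exact h.disj z h5 y h2 ekl.symm⟩
  omega

end Minimal

/-- Far apart vertices of a 2-connected graph yield a long induced ladder. -/
theorem exists_isLambda_of_le_dist {V : Type u} {G : SimpleGraph V} (hG : IsTwoConnected G)
    {n : ℕ} (hn : 1 < n) {a b : V} (hab : n ≤ G.dist a b) :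
    ∃ S : Set V, IsLambda n (G.induce S) := by
  classical
  have hne : a ≠ b := by rintro rfl; simp at hab; omega
  have hex : ∃ d s t p q, s + t = d ∧ IsDisjointPair G a b s t p q := by
    obtain ⟨s, t, p, q, h⟩ := exists_isDisjointPair hG a b hne.symm
    exact ⟨_, s, t, p, q, rfl, h⟩
  obtain ⟨s, t, p, q, hd, h⟩ := Nat.find_spec hex
  have hmin : ∀ s' t' p' q', IsDisjointPair G a b s' t' p' q' → s + t ≤ s' + t' := by
    intro s' t' p' q' h'
    rw [hd]
    exact Nat.find_min' hex ⟨s', t', p', q', rfl, h'⟩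
  have hmin' : ∀ s' t' p' q', IsDisjointPair G a b s' t' p' q' → t + s ≤ s' + t' := by
    intro s' t' p' q' h'
    have := hmin _ _ _ _ h'
    omega
  have injq := h.symm.injOn hmin'
  have hs : n ≤ s := hab.trans (h.left.dist_le hG.2.1)
  have ht : n ≤ t := hab.trans (h.right.dist_le hG.2.1)
  -- The ends `a` and `b` are left to `p`, so the second path is `q 1, …, q (t - 1)`, with last
  -- index `t - 2` after the shift. The end edges of `q` become the outer rungs.
  refine exists_induce_isLambda_of_two_paths G p (fun j => q (j + 1)) s (t - 2) (h.injOn hmin)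
    ?_ ?_ (h.adj_iff hmin) ?_ ?_ ?_ ?_ n hs (by omega)
  · intro i j hi hj e
    have := injq (i + 1) (j + 1) (by omega) (by omega) e
    omega
  · intro i j hi hj e
    rcases h.disj i hi (j + 1) (by omega) e with h' | h'
    · have := injq (j + 1) 0 (by omega) (by omega) (by rw [h.right.zero, ← e, h'])
      omega
    · exact h.right.ne_last (j + 1) (by omega) (e ▸ h')
  · intro i j hi hj
    rw [h.symm.adj_iff hmin' (i + 1) (j + 1) (by omega) (by omega)]
    omega
  · have := h.right.adj 0 (by omega)
    rwa [h.right.zero, ← h.left.zero] at this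
  · have := h.right.adj (t - 2 + 1) (by omega)
    have e : t - 2 + 1 + 1 = t := by omega
    rw [e, h.right.last, ← h.left.last] at this
    exact this.symm
  · intro i i' j j' hi hi' hj hj' h1 h2
    have := h.cross hmin hi hi' (j := j + 1) (j' := j' + 1) (by omega) (by omega) h1 h2
    omega

/-- A vertex together with an induced path that avoids it and joins two of its neighbours. -/
theorem exists_isLambda_of_fan {V : Type u} {G : SimpleGraph V} {v : V} {n : ℕ} (hn : 0 < n)
    (hconn : (G.induce ({v}ᶜ : Set V)).Connected) {x y : ({v}ᶜ : Set V)} (hx : G.Adj v x)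
    (hy : G.Adj v y) (hxy : n ≤ (G.induce ({v}ᶜ : Set V)).dist x y) :
    ∃ S : Set V, IsLambda n (G.induce S) := by
  obtain ⟨p, h0, hl, hadj, hinj, hch⟩ := exists_path_fun (hconn.preconnected x y)
  -- The second path is the single vertex `v`, so no edges cross and every piece is a triangle.
  refine exists_induce_isLambda_of_two_paths G (fun k => (p k : V)) (fun _ => v) _ 0
    (fun i j hi hj e => hinj i j hi hj (Subtype.ext e)) (by intros; omega)
    (fun i _ _ _ => (p i).2) ?_ ?_ ?_ ?_ (by intros; omega) n hxy (by omega)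
  · intro i j hi hj
    constructor
    · exact hch i j hi hj
    · rintro (rfl | rfl)
      · exact hadj i hj
      · exact (hadj j hi).symm
  · intro i j hi hj
    simp only [SimpleGraph.irrefl, false_iff]
    omega
  · rw [h0]; exact hx.symm
  · rw [hl]; exact hy.symm

/-! ### Ramsey's theorem and spiders -/

/-- The usual induction: the set without a vertex `x` splits into neighbours and non-neighbours of
`x`, and `x` enlarges a clique in the former or an independent set in the latter. -/
theorem exists_clique_or_independent (r n : ℕ) : ∃ N : ℕ, ∀ (V : Type u) (G : SimpleGraph V)
    (X : Finset V), N ≤ X.card → (∃ K, G.IsNClique r K) ∨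
      ∃ I ⊆ X, I.card = n ∧ ∀ x ∈ I, ∀ y ∈ I, ¬ G.Adj x y := by
  -- The clique must be kept inside `X`, or `x` could not be added to it.
  suffices h : ∃ N : ℕ, ∀ (V : Type u) (G : SimpleGraph V) (X : Finset V), N ≤ X.card →
      (∃ K ⊆ X, G.IsNClique r K) ∨ ∃ I ⊆ X, I.card = n ∧ ∀ x ∈ I, ∀ y ∈ I, ¬ G.Adj x y by
    obtain ⟨N, hN⟩ := h
    exact ⟨N, fun V G X hX => (hN V G X hX).imp_left fun ⟨K, _, hK⟩ => ⟨K, hK⟩⟩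
  induction r generalizing n with
  | zero => exact ⟨0, fun V G X _ => Or.inl ⟨∅, by simp, by simp⟩⟩
  | succ r ihr =>
  induction n with
  | zero => exact ⟨0, fun V G X _ => Or.inr ⟨∅, by simp, by simp⟩⟩
  | succ n ihn =>
  obtain ⟨N₁, h₁⟩ := ihr (n + 1)
  obtain ⟨N₂, h₂⟩ := ihn
  refine ⟨N₁ + N₂ + 1, fun V G X hX => ?_⟩
  classical
  obtain ⟨x, hx⟩ : X.Nonempty := Finset.card_pos.1 (by omega)
  have hcard := Finset.card_filter_add_card_filter_not (s := X.erase x) (fun y => G.Adj x y)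
  rw [Finset.card_erase_of_mem hx] at hcard
  have sub : ∀ P : V → Prop, [DecidablePred P] → (X.erase x).filter P ⊆ X := fun P _ =>
    (Finset.filter_subset _ _).trans (Finset.erase_subset _ _)
  by_cases h : N₁ ≤ ((X.erase x).filter (fun y => G.Adj x y)).card
  · rcases h₁ V G _ h with ⟨K, hK, hc⟩ | ⟨I, hI, hc⟩
    · refine Or.inl ⟨insert x K, Finset.insert_subset hx (hK.trans (sub _)), hc.insert ?_⟩
      intro b hb
      exact (Finset.mem_filter.1 (hK hb)).2
    · exact Or.inr ⟨I, hI.trans (sub _), hc⟩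
  · rcases h₂ V G ((X.erase x).filter (fun y => ¬ G.Adj x y)) (by omega) with
      ⟨K, hK, hc⟩ | ⟨I, hI, hc, hind⟩
    · exact Or.inl ⟨K, hK.trans (sub _), hc⟩
    · have hxI : x ∉ I := fun hxI => by simpa using hI hxI
      have hnot : ∀ y ∈ I, ¬ G.Adj x y := fun y hy => (Finset.mem_filter.1 (hI hy)).2
      refine Or.inr ⟨insert x I, Finset.insert_subset hx (hI.trans (sub _)), ?_, ?_⟩
      · rw [Finset.card_insert_of_notMem hxI, hc]
      · intro y hy z hz
        rcases Finset.mem_insert.1 hy with rfl | hyI <;>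
          rcases Finset.mem_insert.1 hz with rfl | hzI
        · exact G.loopless.irrefl _
        · exact hnot z hzI
        · exact fun h => hnot y hyI h.symm
        · exact hind y hyI z hzI

/-- Induced paths `p i 0, …, p i (len i)` that start at `c` and are otherwise disjoint, with no edges
between different paths except at `c`. -/
structure IsSpider {V : Type u} (G : SimpleGraph V) (c : V) {ι : Type} (len : ι → ℕ)
    (p : ι → ℕ → V) : Prop where
  zero : ∀ i, p i 0 = c
  pos : ∀ i, 1 ≤ len i
  inj : ∀ i a b, a ≤ len i → b ≤ len i → p i a = p i b → a = b
  adj : ∀ i a, a < len i → G.Adj (p i a) (p i (a + 1))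
  chordless : ∀ i a b, a ≤ len i → b ≤ len i → G.Adj (p i a) (p i b) → a + 1 = b ∨ b + 1 = a
  cross : ∀ i j, i ≠ j → ∀ a b, 1 ≤ a → a ≤ len i → 1 ≤ b → b ≤ len j →
    p i a ≠ p j b ∧ ¬ G.Adj (p i a) (p j b)

theorem IsSpider.truncate {V : Type u} {G : SimpleGraph V} {c : V} {ι : Type} {len : ι → ℕ}
    {p : ι → ℕ → V} (h : IsSpider G c len p) {len' : ι → ℕ} (hpos : ∀ i, 1 ≤ len' i)
    (hle : ∀ i, len' i ≤ len i) : IsSpider G c len' p where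
  zero := h.zero
  pos := hpos
  inj i a b ha hb := h.inj i a b (ha.trans (hle i)) (hb.trans (hle i))
  adj i a ha := h.adj i a (ha.trans_le (hle i))
  chordless i a b ha hb := h.chordless i a b (ha.trans (hle i)) (hb.trans (hle i))
  cross i j hij a b ha ha' hb hb' := h.cross i j hij a b ha (ha'.trans (hle i)) hb (hb'.trans (hle j))

theorem IsSpider.of_induce {V : Type u} {G : SimpleGraph V} {S : Set V} {c : S} {ι : Type}
    {len : ι → ℕ} {p : ι → ℕ → S} (h : IsSpider (G.induce S) c len p) :
    IsSpider G (c : V) len (fun i k => (p i k : V)) where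
  zero i := by rw [h.zero]
  pos := h.pos
  inj i a b ha hb e := h.inj i a b ha hb (Subtype.ext e)
  adj i a ha := h.adj i a ha
  chordless i a b ha hb := h.chordless i a b ha hb
  cross i j hij a b ha ha' hb hb' :=
    ⟨fun e => (h.cross i j hij a b ha ha' hb hb').1 (Subtype.ext e),
      (h.cross i j hij a b ha ha' hb hb').2⟩

theorem isSpider_star {V : Type u} {G : SimpleGraph V} {c : V} {ι : Type} (f : ι → V)
    (hf : Function.Injective f) (hadj : ∀ i, G.Adj c (f i)) (hind : ∀ i j, ¬ G.Adj (f i) (f j)) :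
    IsSpider G c (fun _ : ι => 1) (fun i a => if a = 0 then c else f i) where
  zero i := rfl
  pos i := le_rfl
  inj i a b ha hb e := by
    have hne := (hadj i).ne
    rcases Nat.le_one_iff_eq_zero_or_eq_one.1 ha with rfl | rfl <;>
      rcases Nat.le_one_iff_eq_zero_or_eq_one.1 hb with rfl | rfl <;> simp_all
  adj i a ha := by
    have : a = 0 := by omega
    subst this
    simpa using hadj i
  chordless i a b ha hb e := by
    rcases Nat.le_one_iff_eq_zero_or_eq_one.1 ha with rfl | rfl <;>
      rcases Nat.le_one_iff_eq_zero_or_eq_one.1 hb with rfl | rfl <;> simp_all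
  cross i j hij a b ha ha' hb hb' := by
    rw [if_neg (by omega), if_neg (by omega)]
    exact ⟨fun e => hij (hf e), hind i j⟩

theorem IsSpider.extend {V : Type u} {G : SimpleGraph V} {c : V} {ι : Type} {len : ι → ℕ}
    {p : ι → ℕ → V} (h : IsSpider G c len p) (x : ι → V)
    (hx : ∀ i j a, a ≤ len i → p i a ≠ x j)
    (hadj : ∀ i j a, a ≤ len i → (G.Adj (p i a) (x j) ↔ i = j ∧ a = len i))
    (hind : ∀ i j, ¬ G.Adj (x i) (x j)) :
    IsSpider G c (fun i => len i + 1) (fun i a => if a ≤ len i then p i a else x i) where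
  zero i := by simp [h.zero]
  pos i := by omega
  inj i a b ha hb e := by
    split_ifs at e with h1 h2 h2
    · exact h.inj i a b h1 h2 e
    · exact absurd e (hx i i a h1)
    · exact absurd e.symm (hx i i b h2)
    · omega
  adj i a ha := by
    rw [if_pos (by omega)]
    split_ifs with h1
    · exact h.adj i a h1
    · exact (hadj i i a (by omega)).2 ⟨rfl, by omega⟩
  chordless i a b ha hb e := by
    split_ifs at e with h1 h2 h2
    · exact h.chordless i a b h1 h2 e
    · have := ((hadj i i a h1).1 e).2
      omega
    · have := ((hadj i i b h2).1 e.symm).2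
      omega
    · exact absurd e (hind i i)
  cross i j hij a b ha ha' hb hb' := by
    split_ifs with h1 h2 h2
    · exact h.cross i j hij a b ha h1 hb h2
    · exact ⟨hx i j a h1, fun e => hij ((hadj i j a h1).1 e).1⟩
    · exact ⟨(hx j i b h2).symm, fun e => hij ((hadj j i b h2).1 e.symm).1.symm⟩
    · refine ⟨fun e => ?_, hind i j⟩
      have := (hadj i i (len i) le_rfl).2 ⟨rfl, rfl⟩
      rw [e, hadj i j _ le_rfl] at this
      exact hij this.1

/-- In a graph without large cliques, a large subset of one level of a layering with a single root
contains the ends of a spider whose remaining vertices lie in lower levels. -/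
theorem exists_spider (r M k : ℕ) : ∃ N : ℕ, ∀ (V : Type u) (G : SimpleGraph V) (lev : V → ℕ),
    (∀ x y, G.Adj x y → lev x ≤ lev y + 1) →
    (∀ x n, lev x = n + 1 → ∃ y, G.Adj y x ∧ lev y = n) →
    (∀ x y, lev x = 0 → lev y = 0 → x = y) →
    (∀ K, ¬ G.IsNClique r K) →
    ∀ X : Finset V, (∀ x ∈ X, lev x = k) → N ≤ X.card →
      ∃ (c : V) (len : Fin M → ℕ) (p : Fin M → ℕ → V), IsSpider G c len p ∧
        (∀ i, p i (len i) ∈ X) ∧ ∀ i a, a < len i → lev (p i a) < k := by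
  induction k with
  | zero =>
    refine ⟨2, fun V G lev _ _ hroot _ X hX hc => ?_⟩
    obtain ⟨x, hx, y, hy, hxy⟩ := Finset.one_lt_card.1 hc
    exact absurd (hroot x y (hX x hx) (hX y hy)) hxy
  | succ k ih =>
  obtain ⟨N₁, h₁⟩ := ih
  -- Any size above `N₁ * M` would do: `N₁` or fewer vertices with at most `M` neighbours each
  -- cannot dominate such a set.
  obtain ⟨N, hN⟩ := exists_clique_or_independent.{u} r ((M + 1) * (N₁ + 1))
  refine ⟨N, fun V G lev hlev hdown hroot hK X hX hc => ?_⟩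
  classical
  obtain ⟨I, hIX, hIc, hind⟩ := (hN V G X hc).resolve_left fun ⟨K, h⟩ => hK K h
  -- A vertex of level `k` with `M` neighbours in the independent set `I` is already the centre of a
  -- spider.
  by_cases hstar : ∃ y, lev y = k ∧ M ≤ (I.filter (G.Adj y)).card
  · obtain ⟨y, hy, hM⟩ := hstar
    obtain ⟨f⟩ : Nonempty (Fin M ↪ (I.filter (G.Adj y) : Finset V)) :=
      Function.Embedding.nonempty_of_card_le (by simpa using hM)
    have hf : ∀ i, (f i : V) ∈ I ∧ G.Adj y (f i) := fun i => Finset.mem_filter.1 (f i).2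
    refine ⟨y, _, _, isSpider_star (fun i => (f i : V)) (Subtype.val_injective.comp f.injective)
      (fun i => (hf i).2) (fun i j => hind _ (hf i).1 _ (hf j).1), ?_, ?_⟩
    · intro i; simpa using hIX (hf i).1
    · intro i a ha
      rw [if_pos (by omega), hy]; omega
  push Not at hstar
  choose! g hg hg' using fun (x : V) (hx : x ∈ I) => hdown x k (hX x (hIX hx))
  let P : Finset V → Prop := fun Y => (∀ y ∈ Y, lev y = k) ∧ ∀ x ∈ I, ∃ y ∈ Y, G.Adj y x
  have hP : P (I.image g) := by
    refine ⟨?_, fun x hx => ⟨g x, Finset.mem_image_of_mem g hx, hg x hx⟩⟩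
    intro y hy
    obtain ⟨x, hx, rfl⟩ := Finset.mem_image.1 hy
    exact hg' x hx
  -- In a minimal subset `Y` of level `k` dominating `I`, every vertex has a private neighbour in
  -- `I`. The spider obtained for `Y` by induction is lengthened by these; its vertices below level
  -- `k` have no neighbours in level `k + 1`.
  obtain ⟨Y, -, hY⟩ := exists_minimal_le_of_wellFoundedLT P _ hP
  have hpriv : ∀ y ∈ Y, ∃ x ∈ I, ∀ z ∈ Y, G.Adj z x ↔ z = y := by
    intro y hy
    have hn : ¬ P (Y.erase y) := fun h =>
      Finset.notMem_erase y Y (hY.2 h (Finset.erase_subset y Y) hy)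
    have : ∃ x ∈ I, ∀ z ∈ Y.erase y, ¬ G.Adj z x := by
      by_contra hcon
      push Not at hcon
      exact hn ⟨fun z hz => hY.1.1 z (Finset.mem_of_mem_erase hz), hcon⟩
    obtain ⟨x, hx, hxz⟩ := this
    have key : ∀ z ∈ Y, G.Adj z x → z = y := by
      intro z hz hzx
      by_contra hne
      exact hxz z (Finset.mem_erase.2 ⟨hne, hz⟩) hzx
    refine ⟨x, hx, fun z hz => ⟨key z hz, ?_⟩⟩
    rintro rfl
    obtain ⟨w, hw, hwx⟩ := hY.1.2 x hx
    rwa [← key w hw hwx]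
  have hYc : N₁ ≤ Y.card := by
    have hsub : I ⊆ Y.biUnion (fun y => I.filter (G.Adj y)) := by
      intro x hx
      obtain ⟨y, hy, hyx⟩ := hY.1.2 x hx
      exact Finset.mem_biUnion.2 ⟨y, hy, Finset.mem_filter.2 ⟨hx, hyx⟩⟩
    have h1 := Finset.card_le_card hsub
    have h2 := Finset.card_biUnion_le_card_mul Y (fun y => I.filter (G.Adj y)) M
      fun y hy => (hstar y (hY.1.1 y hy)).le
    by_contra hlt
    have h3 : Y.card * M ≤ N₁ * M := Nat.mul_le_mul_right M (by omega)
    have h4 : (M + 1) * (N₁ + 1) = N₁ * M + M + N₁ + 1 := by ring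
    omega
  obtain ⟨c, len, p, hsp, hend, hlow⟩ := h₁ V G lev hlev hdown hroot hK Y hY.1.1 hYc
  choose! e heI heY using hpriv
  have hxI : ∀ i, e (p i (len i)) ∈ I := fun i => heI _ (hend i)
  have hxl : ∀ i, lev (e (p i (len i))) = k + 1 := fun i => hX _ (hIX (hxI i))
  have hpl : ∀ i a, a ≤ len i → lev (p i a) ≤ k := by
    intro i a ha
    rcases Nat.lt_or_ge a (len i) with h | h
    · exact (hlow i a h).le
    · rw [le_antisymm ha h, hY.1.1 _ (hend i)]
  refine ⟨c, _, _, hsp.extend (fun i => e (p i (len i))) ?_ ?_ ?_, ?_, ?_⟩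
  · intro i j a ha he
    have h1 := hpl i a ha
    rw [he, hxl] at h1
    omega
  · intro i j a ha
    constructor
    · intro hadj
      have hal : a = len i := by
        by_contra hne
        have h1 := hlow i a (by omega)
        have h2 := hlev _ _ hadj.symm
        rw [hxl] at h2
        omega
      subst hal
      refine ⟨?_, rfl⟩
      by_contra hij
      have := (heY _ (hend j) _ (hend i)).1 hadj
      exact (hsp.cross i j hij _ _ (hsp.pos i) le_rfl (hsp.pos j) le_rfl).1 this
    · rintro ⟨rfl, rfl⟩
      exact (heY _ (hend i) _ (hend i)).2 rfl
  · exact fun i j => hind _ (hxI i) _ (hxI j)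
  · intro i
    simpa using hIX (hxI i)
  · intro i a ha
    rw [if_pos (by omega)]
    have := hpl i a (by omega)
    omega

/-! ### Theta graphs from spiders -/

theorem exists_walk_of_fun {W : Type u} {H : SimpleGraph W} (p : ℕ → W) (n : ℕ)
    (h : ∀ k < n, H.Adj (p k) (p (k + 1))) {a b : W} (ha : p 0 = a) (hb : p n = b) :
    ∃ w : H.Walk a b, w.support = (List.range (n + 1)).map p ∧
      w.edges = (List.range n).map (fun k => s(p k, p (k + 1))) := by
  subst ha hb
  induction n with
  | zero => exact ⟨SimpleGraph.Walk.nil, by simp, by simp⟩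
  | succ n ih =>
    obtain ⟨w, hw, he⟩ := ih fun k hk => h k (by omega)
    refine ⟨w.concat (h n (by omega)), ?_, ?_⟩
    · rw [SimpleGraph.Walk.support_concat, hw, List.range_succ (n := n + 1)]
      simp
    · rw [SimpleGraph.Walk.edges_concat, he, List.range_succ (n := n)]
      simp

/-- The hypothesis `one` is what makes the paths distinct: coinciding paths with different indices
have no inner vertices by `disj`, so both would be the edge `ab`. The hypothesis `ind` says that the
paths carry all edges induced on their union. -/
theorem exists_induce_isTheta {V : Type u} (G : SimpleGraph V) {n : ℕ} (hn : 0 < n) {a b : V}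
    (hab : a ≠ b) (L : Fin n → ℕ) (p : Fin n → ℕ → V) (h0 : ∀ i, p i 0 = a)
    (hL : ∀ i, p i (L i) = b) (adj : ∀ i, ∀ k < L i, G.Adj (p i k) (p i (k + 1)))
    (inj : ∀ i k l, k ≤ L i → l ≤ L i → p i k = p i l → k = l)
    (disj : ∀ i j, i ≠ j → ∀ k ≤ L i, ∀ l ≤ L j, p i k = p j l → p i k = a ∨ p i k = b)
    (one : ∀ i j, L i = 1 → L j = 1 → i = j)
    (ind : ∀ i j, ∀ k ≤ L i, ∀ l ≤ L j, G.Adj (p i k) (p j l) →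
      ∃ i' k', k' < L i' ∧ s(p i k, p j l) = s(p i' k', p i' (k' + 1))) :
    ∃ S : Set V, IsTheta n (G.induce S) := by
  let S : Set V := {x | ∃ i k, k ≤ L i ∧ p i k = x}
  let i₀ : Fin n := ⟨0, hn⟩
  let p' : Fin n → ℕ → S := fun i k => ⟨p i (min k (L i)), i, _, min_le_right _ _, rfl⟩
  have ep : ∀ {i k}, k ≤ L i → (p' i k : V) = p i k := fun h => by simp [p', min_eq_left h]
  let a' : S := ⟨a, i₀, 0, Nat.zero_le _, h0 _⟩
  let b' : S := ⟨b, i₀, L i₀, le_rfl, hL _⟩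
  have hadj' : ∀ i, ∀ k < L i, (G.induce S).Adj (p' i k) (p' i (k + 1)) := by
    intro i k hk
    rw [SimpleGraph.comap_adj, Function.Embedding.subtype_apply, Function.Embedding.subtype_apply,
      ep hk.le, ep hk]
    exact adj i k hk
  choose w hws hwe using fun i => exists_walk_of_fun (p' i) (L i) (hadj' i) (a := a') (b := b')
    (Subtype.ext (by rw [ep (Nat.zero_le _), h0])) (Subtype.ext (by rw [ep le_rfl, hL]))
  have mem : ∀ i x, x ∈ (w i).support ↔ ∃ k ≤ L i, p i k = x := by
    intro i x
    rw [hws]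
    simp only [List.mem_map, List.mem_range]
    constructor
    · rintro ⟨k, hk, rfl⟩
      exact ⟨k, by omega, (ep (by omega)).symm⟩
    · rintro ⟨k, hk, e⟩
      exact ⟨k, by omega, Subtype.ext ((ep hk).trans e)⟩
  have hpath : ∀ i, (w i).IsPath := by
    intro i
    rw [SimpleGraph.Walk.isPath_def, hws]
    refine List.Nodup.map_on ?_ List.nodup_range
    intro k hk l hl e
    rw [List.mem_range] at hk hl
    refine inj i k l (by omega) (by omega) ?_
    rw [← ep (show k ≤ L i by omega), ← ep (show l ≤ L i by omega), e]
  have hdisj : ∀ i j, i ≠ j → ∀ x : S, x ∈ (w i).support → x ∈ (w j).support →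
      x = a' ∨ x = b' := by
    intro i j hij x hi hj
    obtain ⟨k, hk, e⟩ := (mem i x).1 hi
    obtain ⟨l, hl, e'⟩ := (mem j x).1 hj
    rcases disj i j hij k hk l hl (e.trans e'.symm) with h | h
    · exact Or.inl (Subtype.ext (e.symm.trans h))
    · exact Or.inr (Subtype.ext (e.symm.trans h))
  have hLpos : ∀ i, 1 ≤ L i := by
    intro i
    by_contra h
    have h1 : L i = 0 := by omega
    have h2 := hL i
    rw [h1, h0] at h2
    exact hab h2
  have short : ∀ i j, i ≠ j → (∀ x, x ∈ (w i).support → x ∈ (w j).support) → L i = 1 := by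
    intro i j hij hsub
    have hi : p' i 1 ∈ (w i).support := (mem _ _).2 ⟨1, hLpos i, (ep (hLpos i)).symm⟩
    rcases hdisj i j hij _ hi (hsub _ hi) with h | h
    · have := inj i 1 0 (hLpos i) (Nat.zero_le _) (by rw [h0, ← ep (hLpos i), h])
      omega
    · exact (inj i 1 (L i) (hLpos i) le_rfl (by rw [hL, ← ep (hLpos i), h])).symm
  refine ⟨S, a', b', fun i => ⟨w i, hpath i⟩, fun e => hab (congrArg Subtype.val e), ?_, hdisj,
    ?_, ?_⟩
  · intro i j hij
    have hw : w i = w j := congrArg Subtype.val hij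
    by_contra hne
    exact hne (one i j (short i j hne fun x hx => hw ▸ hx)
      (short j i (Ne.symm hne) fun x hx => hw ▸ hx))
  · rintro ⟨x, i, k, hk, rfl⟩
    exact ⟨i, (mem _ _).2 ⟨k, hk, rfl⟩⟩
  · intro d
    induction d with
    | _ x y =>
    intro hd
    obtain ⟨x, i, k, hk, rfl⟩ := x
    obtain ⟨y, j, l, hl, rfl⟩ := y
    obtain ⟨i', k', hk', e⟩ := ind i j k hk l hl hd
    refine ⟨i', ?_⟩
    change _ ∈ (w i').edges
    rw [hwe, List.mem_map]
    refine ⟨k', List.mem_range.2 hk', ?_⟩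
    apply Sym2.map.injective Subtype.val_injective
    rw [Sym2.map_mk, Sym2.map_mk, ep hk'.le, ep hk', e]

/-- A spider whose ends are adjacent to a further vertex `v` contains a theta graph. -/
theorem exists_isTheta_of_spider {V : Type u} {G : SimpleGraph V} {n : ℕ} (hn : 0 < n) {c v : V}
    {len : Fin n → ℕ} {p : Fin n → ℕ → V} (h : IsSpider G c len p)
    (hv : ∀ i k, k ≤ len i → p i k ≠ v) (hend : ∀ i, G.Adj v (p i (len i))) :
    ∃ S : Set V, IsTheta n (G.induce S) := by
  classical
  have hex : ∀ i, ∃ k, 1 ≤ k ∧ k ≤ len i ∧ G.Adj v (p i k) :=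
    fun i => ⟨len i, h.pos i, le_rfl, hend i⟩
  -- cut each leg at the first neighbour of `v`
  obtain ⟨len, h, hv, hend, hfirst⟩ : ∃ len : Fin n → ℕ, IsSpider G c len p ∧
      (∀ i k, k ≤ len i → p i k ≠ v) ∧ (∀ i, G.Adj v (p i (len i))) ∧
      (∀ i k, 1 ≤ k → k ≤ len i → G.Adj v (p i k) → k = len i) := by
    refine ⟨fun i => Nat.find (hex i), h.truncate (fun i => (Nat.find_spec (hex i)).1)
      (fun i => (Nat.find_spec (hex i)).2.1),
      fun i k hk => hv i k (hk.trans (Nat.find_spec (hex i)).2.1),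
      fun i => (Nat.find_spec (hex i)).2.2, ?_⟩
    intro i k h1 h2 h3
    have := Nat.find_min' (hex i) ⟨h1, h2.trans (Nat.find_spec (hex i)).2.1, h3⟩
    exact le_antisymm h2 this
  let i₀ : Fin n := ⟨0, hn⟩
  -- If `v` is adjacent to the centre `c`, the edge `cv` is induced anyway; it then serves as a path
  -- in place of leg `i₀`, which keeps the number of paths at `n`.
  let L : Fin n → ℕ := fun i => if G.Adj v c ∧ i = i₀ then 1 else len i + 1
  let p' : Fin n → ℕ → V := fun i k => if k < L i then p i k else v
  have hLcase : ∀ i, (L i = 1 ∧ G.Adj v c ∧ i = i₀) ∨ L i = len i + 1 := by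
    intro i
    simp only [L]
    split_ifs with hi
    · exact Or.inl ⟨rfl, hi⟩
    · exact Or.inr rfl
  have hL1 : ∀ i, 1 ≤ L i := by intro i; rcases hLcase i with h | h <;> omega
  have hLlen : ∀ i, L i ≤ len i + 1 := by
    intro i; rcases hLcase i with h | h <;> omega
  have lt : ∀ {i k}, k < L i → p' i k = p i k := fun hk => if_pos hk
  have last : ∀ i, p' i (L i) = v := fun i => if_neg (lt_irrefl _)
  have hnv : ∀ {i k}, k < L i → p i k ≠ v := fun {i k} hk => hv i k (by have := hLlen i; omega)
  have adjv : ∀ i k, k < L i → G.Adj v (p i k) → k + 1 = L i ∨ (k = 0 ∧ G.Adj v c) := by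
    intro i k hk hadj
    have := hLlen i
    rcases Nat.eq_zero_or_pos k with rfl | hk0
    · rw [h.zero] at hadj; exact Or.inr ⟨rfl, hadj⟩
    · left
      have h1 := hfirst i k hk0 (by omega) hadj
      rcases hLcase i with h2 | h2 <;> omega
  have adjlast : ∀ i, G.Adj (p i (L i - 1)) v := by
    intro i
    rcases hLcase i with ⟨h1, h2, -⟩ | h1
    · rw [h1, h.zero]; exact h2.symm
    · rw [h1]; exact (hend i).symm
  have hcv : c ≠ v := by rw [← h.zero i₀]; exact hv i₀ 0 (Nat.zero_le _)
  refine exists_induce_isTheta G hn hcv L p' ?_ last ?_ ?_ ?_ ?_ ?_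
  · intro i; rw [lt (hL1 i), h.zero]
  · intro i k hk
    rw [lt hk]
    rcases Nat.lt_or_ge (k + 1) (L i) with h1 | h1
    · rw [lt h1]; exact h.adj i k (by have := hLlen i; omega)
    · have : k + 1 = L i := by omega
      rw [this, last]
      have e : k = L i - 1 := by omega
      rw [e]; exact adjlast i
  · intro i k l hk hl e
    have := hLlen i
    rcases hk.lt_or_eq with hk | rfl <;> rcases hl.lt_or_eq with hl | rfl
    · rw [lt hk, lt hl] at e; exact h.inj i k l (by omega) (by omega) e
    · rw [lt hk, last] at e; exact absurd e (hnv hk)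
    · rw [lt hl, last] at e; exact absurd e.symm (hnv hl)
    · rfl
  · intro i j hij k hk l hl e
    have := hLlen i
    have := hLlen j
    rcases hk.lt_or_eq with hk | rfl
    · rcases hl.lt_or_eq with hl | rfl
      · left
        rw [lt hk, lt hl] at e
        rw [lt hk]
        rcases Nat.eq_zero_or_pos k with rfl | hk0
        · exact h.zero i
        rcases Nat.eq_zero_or_pos l with rfl | hl0
        · rw [e]; exact h.zero j
        exact absurd e (h.cross i j hij k l hk0 (by omega) hl0 (by omega)).1
      · rw [e]; exact Or.inr (last j)
    · exact Or.inr (last i)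
  · intro i j hi hj
    have := h.pos i
    have := h.pos j
    rcases hLcase i with h1 | h1
    · rcases hLcase j with h2 | h2
      · rw [h1.2.2, h2.2.2]
      · omega
    · omega
  · -- edges between two vertices other than `v`
    have inner : ∀ i k l, k < L i → l < L i → G.Adj (p i k) (p i l) →
        ∃ i' k', k' < L i' ∧ s(p i k, p i l) = s(p' i' k', p' i' (k' + 1)) := by
      intro i k l hk hl hadj
      have := hLlen i
      rcases h.chordless i k l (by omega) (by omega) hadj with rfl | rfl
      · exact ⟨i, k, hk, by rw [lt hk, lt hl]⟩
      · exact ⟨i, l, hl, by rw [lt hk, lt hl, Sym2.eq_swap]⟩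
    have outer : ∀ i k, k < L i → G.Adj v (p i k) →
        ∃ i' k', k' < L i' ∧ s(p i k, v) = s(p' i' k', p' i' (k' + 1)) := by
      intro i k hk hadj
      rcases adjv i k hk hadj with h1 | ⟨rfl, h1⟩
      · exact ⟨i, k, hk, by rw [lt hk, h1, last]⟩
      · have h2 : L i₀ = 1 := by simp only [L, h1, and_self, if_true]
        refine ⟨i₀, 0, by omega, ?_⟩
        have h3 : p' i₀ (0 + 1) = v := by rw [← last i₀, h2]
        rw [lt (by omega), h3, h.zero, h.zero]
    intro i j k hk l hl hadj
    have := hLlen i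
    have := hLlen j
    rcases hk.lt_or_eq with hk | rfl <;> rcases hl.lt_or_eq with hl | rfl
    · rw [lt hk, lt hl] at hadj ⊢
      by_cases hij : i = j
      · subst hij; exact inner i k l hk hl hadj
      rcases Nat.eq_zero_or_pos k with rfl | hk0
      · rw [h.zero, ← h.zero j] at hadj ⊢
        exact inner j 0 l (hL1 j) hl hadj
      rcases Nat.eq_zero_or_pos l with rfl | hl0
      · rw [h.zero j, ← h.zero i] at hadj ⊢
        exact inner i k 0 hk (hL1 i) hadj
      exact absurd hadj (h.cross i j hij k l hk0 (by omega) hl0 (by omega)).2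
    · rw [lt hk, last] at hadj ⊢
      exact outer i k hk hadj.symm
    · rw [lt hl, last] at hadj ⊢
      rw [Sym2.eq_swap]
      exact outer j l hl hadj
    · rw [last, last] at hadj
      exact absurd hadj (G.loopless.irrefl _)

/-! ### Bounded degree and the main theorem -/

theorem card_ball_le {V : Type u} [Fintype V] [DecidableEq V] {G : SimpleGraph V}
    [DecidableRel G.Adj] (hG : G.Connected) {d : ℕ} (hd : ∀ v, G.degree v ≤ d) (a : V) (k : ℕ) :
    (Finset.univ.filter fun x => G.dist a x ≤ k).card ≤ (d + 1) ^ k := by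
  induction k with
  | zero =>
    refine (Finset.card_le_card (t := {a}) fun x hx => ?_).trans (by simp)
    have h : G.dist a x = 0 := by simpa using hx
    exact Finset.mem_singleton.2 (hG.dist_eq_zero_iff.1 h).symm
  | succ k ih =>
    have hsub : (Finset.univ.filter fun x => G.dist a x ≤ k + 1) ⊆
        (Finset.univ.filter fun x => G.dist a x ≤ k).biUnion
          fun y => insert y (G.neighborFinset y) := by
      intro x hx
      have hx : G.dist a x ≤ k + 1 := by simpa using hx
      simp only [Finset.mem_biUnion, Finset.mem_filter, Finset.mem_univ, true_and,
        Finset.mem_insert, SimpleGraph.mem_neighborFinset]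
      rcases Nat.lt_or_ge k (G.dist a x) with h | h
      · obtain ⟨y, hyx, hy⟩ := exists_pred_of_dist hG a x k (by omega)
        exact ⟨y, hy.le, Or.inr hyx⟩
      · exact ⟨x, h, Or.inl rfl⟩
    calc _ ≤ _ := Finset.card_le_card hsub
      _ ≤ _ * (d + 1) := Finset.card_biUnion_le_card_mul _ _ _ fun y _ =>
          (Finset.card_insert_le _ _).trans (Nat.succ_le_succ (hd y))
      _ ≤ (d + 1) ^ k * (d + 1) := Nat.mul_le_mul_right _ ih
      _ = _ := (pow_succ _ _).symm

theorem theorem1p3 (r : ℕ) (hr : 2 < r) :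
    ∃ N : ℕ, ∀ (V : Type u) [Fintype V] (G : SimpleGraph V),
      IsTwoConnected G → N ≤ Fintype.card V →
        SimpleGraph.IsIndContained (SimpleGraph.completeGraph (Fin r)) G ∨
        (∃ s : Set V, IsTheta r (G.induce s)) ∨
        (∃ s : Set V, IsLambda r (G.induce s)) := by
  choose N hN using fun k => exists_spider.{u} r r k
  -- More than `d` neighbours spread over the distances `0, …, r - 1` put at least `N k` of them at
  -- some distance `k`. With all degrees at most `d` and all distances below `r`, there are at most
  -- `(d + 1) ^ r` vertices.
  let d := ∑ k ∈ Finset.range r, N k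
  refine ⟨(d + 1) ^ r + 1, fun V _ G hG hV => ?_⟩
  classical
  by_cases hK : G.CliqueFree r
  swap
  · exact Or.inl ⟨SimpleGraph.topEmbeddingOfNotCliqueFree hK⟩
  by_cases hfar : ∃ a b, r ≤ G.dist a b
  · obtain ⟨a, b, hab⟩ := hfar
    exact Or.inr (Or.inr (exists_isLambda_of_le_dist hG (by omega) hab))
  push Not at hfar
  obtain ⟨v, hv⟩ : ∃ v, d < G.degree v := by
    by_contra hcon
    push Not at hcon
    obtain ⟨a⟩ := hG.2.1.nonempty
    have h1 := card_ball_le hG.2.1 hcon a r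
    rw [Finset.filter_true_of_mem fun x _ => (hfar a x).le, Finset.card_univ] at h1
    omega
  have hH := hG.2.2 v
  set H := G.induce ({v}ᶜ : Set V)
  let X : Finset ({v}ᶜ : Set V) := Finset.univ.filter fun x => G.Adj v x
  have hX : X.card = G.degree v := by
    rw [← SimpleGraph.card_neighborFinset_eq_degree]
    refine Finset.card_bij (fun x _ => (x : V)) ?_ ?_ ?_
    · intro x hx; simpa [X] using hx
    · intro x _ y _ e; exact Subtype.ext e
    · intro y hy
      have hy : G.Adj v y := by simpa using hy
      exact ⟨⟨y, hy.ne'⟩, by simpa [X] using hy, rfl⟩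
  obtain ⟨x₀, hx₀⟩ : X.Nonempty := Finset.card_pos.1 (by omega)
  have hx₀ : G.Adj v x₀ := by simpa [X] using hx₀
  by_cases hfan : ∃ x ∈ X, r ≤ H.dist x₀ x
  · obtain ⟨x, hx, hd⟩ := hfan
    exact Or.inr (Or.inr (exists_isLambda_of_fan (by omega) hH hx₀ (by simpa [X] using hx) hd))
  push Not at hfan
  obtain ⟨k, hk⟩ : ∃ k, N k ≤ (X.filter fun x => H.dist x₀ x = k).card := by
    by_contra hcon
    push Not at hcon
    have h1 := Finset.card_eq_sum_card_fiberwise (s := X) (t := Finset.range r)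
      (f := fun x => H.dist x₀ x) fun x hx => by simpa using hfan x hx
    have h2 : ∑ k ∈ Finset.range r, (X.filter fun x => H.dist x₀ x = k).card ≤ d :=
      Finset.sum_le_sum fun k _ => (hcon k).le
    omega
  -- The layering is by distance from `x₀` in `G - v`, whose only vertex of level 0 is `x₀`.
  obtain ⟨c, len, p, hsp, hend, -⟩ := hN k _ H (fun x => H.dist x₀ x)
    (fun x y hxy => by
      have h1 := hH.dist_triangle (u := x₀) (v := y) (w := x)
      rw [SimpleGraph.dist_eq_one_iff_adj.2 hxy.symm] at h1
      exact h1)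
    (fun x n h => exists_pred_of_dist hH x₀ x n h)
    (fun x y hx hy => by rw [← hH.dist_eq_zero_iff.1 hx, ← hH.dist_eq_zero_iff.1 hy])
    (hK.comap ⟨(SimpleGraph.Embedding.induce _).toCopy⟩)
    _ (fun x hx => (Finset.mem_filter.1 hx).2) hk
  refine Or.inr (Or.inl (exists_isTheta_of_spider (by omega) hsp.of_induce
    (fun i k _ => (p i k).2) fun i => ?_))
  simpa [X] using (Finset.mem_filter.1 (hend i)).1
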